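/- Let $n\ge 0$. Let $\mathfrak{igl}(n)$ be the complex Lie algebra with basis $L^\mu_\nu, P_\mu$ ($0\le\mu,\nu\le n-1$) and brackets $$[L^\mu_\nu,L^\rho_\lambda]=-i\delta^\rho_\nu L^\mu_\lambda+i\delta^\mu_\lambda L^\rho_\nu,\qquad [L^\mu_\nu,P_\lambda]=i\delta^\mu_\lambda P_\nu,\qquad [P_\mu,P_\nu]=0,$$ let $U=\mathcal U_{\mathfrak{igl}(n)}$ be its enveloping algebra with the primitive coproduct $\Delta$ and counit $\epsilon$, and let $U$ act on $\mathfrak X^n=\mathbb C[x^0,\dots,x^{n-1}]$ so that elements of $\mathfrak{igl}(n)$ act by derivations, with $P_\mu\triangleright x^\nu=-i\delta^\nu_\mu$ and $L^\mu_\nu\triangleright x^\rho=-i\delta^\rho_\nu x^\mu$. All maps are extended $\mathbb C[[h]]$-linearly to the $h$-adic modules $U[[h]]$, $\mathfrak X^n[[h]]$, and the (completed) tensor product of $V[[h]]$ and $W[[h]]$ is $(V\otimes W)[[h]]$. Let $\mathcal F$ be an $\mathfrak{igl}(n)$-twist: an invertible element of $(U\otimes U)[[h]]$ with $\mathcal F=1\otimes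 1+O(h)$ and $$\mathcal F_{12}(\Delta\otimes\mathrm{id})\mathcal F=\mathcal F_{23}(\mathrm{id}\otimes\Delta)\mathcal F,\qquad (\epsilon\otimes\mathrm{id})\mathcal F=1=(\mathrm{id}\otimes\epsilon)\mathcal F .$$ Write $\mathcal F^{-1}=\bar f^\alpha\otimes\bar f_\alpha$. Let $\mathfrak X^n[[h]]^{\mathcal F}$ be $\mathfrak X^n[[h]]$ with the product $f\star g=(\bar f^\alpha\triangleright f)(\bar f_\alpha\triangleright g)$, and $(U[[h]])^{\mathcal F}$ be the algebra $U[[h]]$ with the coproduct $\Delta^{\mathcal F}(\cdot)=\mathcal F\Delta(\cdot)\mathcal F^{-1}$. The smash products $\mathfrak X^n[[h]]\rtimes U[[h]]$ and $\mathfrak X^n[[h]]^{\mathcal F}\rtimes(U[[h]])^{\mathcal F}$ are the $\mathbb C[[h]]$-module $(\mathfrak X^n\otimes U)[[h]]$ with unit $1\otimes 1$ and with the product $$(f\otimes L)\#(g\otimes M)=f\,(L_{(1)}\triangleright g)\otimes L_{(2)}M,$$ formed with the undeformed product of $\mathfrak X^n[[h]]$ and coproduct $\Delta$ in the first case, with $\star$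 and $\Delta^{\mathcal F}$ in the second. Then both are unital associative $\mathbb C[[h]]$-algebras, and there is an isomorphism of $\mathbb C[[h]]$-algebras $$\varphi:\ \mathfrak X^n[[h]]^{\mathcal F}\rtimes(U[[h]])^{\mathcal F}\ \longrightarrow\ \mathfrak X^n[[h]]\rtimes U[[h]]$$ with $\varphi(f\otimes 1)=(\bar f^\alpha\triangleright f)\otimes\bar f_\alpha$ for $f\in\mathfrak X^n[[h]]$ and $\varphi(1\otimes L)=1\otimes L$ for $L\in U[[h]]$. Moreover, $\varphi$ is congruent to the identity map of $(\mathfrak X^n\otimes U)[[h]]$ modulo $h$. -/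

import Mathlib

open scoped TensorProduct PowerSeries

noncomputable section

namespace TwistSmash

/-! ### The Lie algebra `𝔦𝔤𝔩(n)` -/

/-- The Lie algebra `𝔦𝔤𝔩(n) = 𝔤𝔩(n) ⋉ 𝔱ⁿ` over `ℂ`, in coordinates with respect to its generators:
the pair `(gl, tr)` stands for `∑ gl μ ν • L^μ_ν + ∑ tr μ • P_μ`. -/
@[ext]
structure IGL (n : ℕ) where
  gl : Matrix (Fin n) (Fin n) ℂ
  tr : Fin n → ℂ

namespace IGL

variable {n : ℕ}

/-- The underlying vector space is `Matₙ(ℂ) × ℂⁿ`. -/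
def toProd (n : ℕ) : IGL n ≃ Matrix (Fin n) (Fin n) ℂ × (Fin n → ℂ) where
  toFun x := (x.gl, x.tr)
  invFun x := ⟨x.1, x.2⟩
  left_inv _ := rfl
  right_inv _ := rfl

instance : AddCommGroup (IGL n) := (toProd n).addCommGroup

instance : Module ℂ (IGL n) := (toProd n).module ℂ

@[simp] theorem zero_gl : (0 : IGL n).gl = 0 := rfl
@[simp] theorem zero_tr : (0 : IGL n).tr = 0 := rfl
@[simp] theorem add_gl (x y : IGL n) : (x + y).gl = x.gl + y.gl := rfl
@[simp] theorem add_tr (x y : IGL n) : (x + y).tr = x.tr + y.tr := rfl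
@[simp] theorem sub_gl (x y : IGL n) : (x - y).gl = x.gl - y.gl := rfl
@[simp] theorem sub_tr (x y : IGL n) : (x - y).tr = x.tr - y.tr := rfl
@[simp] theorem neg_gl (x : IGL n) : (-x).gl = -x.gl := rfl
@[simp] theorem neg_tr (x : IGL n) : (-x).tr = -x.tr := rfl
@[simp] theorem smul_gl (c : ℂ) (x : IGL n) : (c • x).gl = c • x.gl := rfl
@[simp] theorem smul_tr (c : ℂ) (x : IGL n) : (c • x).tr = c • x.tr := rfl

/-- The bracket, `ℂ`-bilinearly extended from
`[L^μ_ν, L^ρ_λ] = -i δ^ρ_ν L^μ_λ + i δ^μ_λ L^ρ_ν`, `[L^μ_ν, P_λ] = i δ^μ_λ P_ν`, `[P_μ, P_ν] = 0`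
(see `lie_L_L`, `lie_L_P`, `lie_P_P`). -/
instance : Bracket (IGL n) (IGL n) where
  bracket x y :=
    ⟨(-Complex.I) • (x.gl * y.gl - y.gl * x.gl),
      Complex.I • (Matrix.mulVec x.gl.transpose y.tr - Matrix.mulVec y.gl.transpose x.tr)⟩

@[simp] theorem lie_gl (x y : IGL n) :
    ⁅x, y⁆.gl = (-Complex.I) • (x.gl * y.gl - y.gl * x.gl) := rfl

@[simp] theorem lie_tr (x y : IGL n) :
    ⁅x, y⁆.tr = Complex.I •
      (Matrix.mulVec x.gl.transpose y.tr - Matrix.mulVec y.gl.transpose x.tr) := rfl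

instance : LieRing (IGL n) where
  add_lie x y z := by
    ext1
    · simp only [lie_gl, add_gl, add_mul, mul_add, ← smul_add]; congr 1; abel
    · simp only [lie_tr, add_tr, add_gl, Matrix.transpose_add, Matrix.add_mulVec,
        Matrix.mulVec_add, ← smul_add]; congr 1; abel
  lie_add x y z := by
    ext1
    · simp only [lie_gl, add_gl, add_mul, mul_add, ← smul_add]; congr 1; abel
    · simp only [lie_tr, add_tr, add_gl, Matrix.transpose_add, Matrix.add_mulVec,
        Matrix.mulVec_add, ← smul_add]; congr 1; abel
  lie_self x := by ext1 <;> simp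
  leibniz_lie x y z := by
    ext1
    · simp only [lie_gl, add_gl, smul_mul_assoc, mul_smul_comm, ← smul_sub, ← smul_add]
      congr 2
      noncomm_ring
    · simp only [lie_gl, lie_tr, add_tr, Matrix.transpose_smul, Matrix.transpose_sub,
        Matrix.transpose_mul, Matrix.transpose_neg, Matrix.neg_mulVec, Matrix.smul_mulVec,
        Matrix.mulVec_smul, Matrix.sub_mulVec, Matrix.mulVec_sub, Matrix.mulVec_mulVec, smul_sub,
        neg_smul, smul_neg]
      abel

instance : LieAlgebra ℂ (IGL n) where
  lie_smul c x y := by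
    ext1
    · simp only [lie_gl, smul_gl, mul_smul_comm, smul_mul_assoc, ← smul_sub]
      rw [smul_comm]
    · simp only [lie_tr, smul_tr, smul_gl, Matrix.transpose_smul, Matrix.smul_mulVec,
        Matrix.mulVec_smul, ← smul_sub]
      rw [smul_comm]

/-- The generator `L^μ_ν` of `𝔤𝔩(n)`. -/
def L (μ ν : Fin n) : IGL n := ⟨Matrix.single μ ν 1, 0⟩

/-- The generator `P_μ` of the translations `𝔱ⁿ`. -/
def P (μ : Fin n) : IGL n := ⟨0, Pi.single μ 1⟩

theorem lie_L_L (μ ν ρ l : Fin n) :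
    ⁅L μ ν, L ρ l⁆ = (-Complex.I * if ν = ρ then 1 else 0) • L μ l
      + (Complex.I * if l = μ then 1 else 0) • L ρ ν := by
  ext1
  · by_cases h₁ : ν = ρ <;> by_cases h₂ : l = μ <;>
      simp [L, h₁, h₂, sub_eq_add_neg]
  · by_cases h₁ : ν = ρ <;> by_cases h₂ : l = μ <;> simp [L, h₁, h₂]

theorem lie_L_P (μ ν l : Fin n) :
    ⁅L μ ν, P l⁆ = (Complex.I * if l = μ then 1 else 0) • P ν := by
  ext1
  · by_cases h : l = μ <;> simp [L, P, h]
  · ext i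
    by_cases h : l = μ
    · subst h
      simp [L, P, Matrix.transpose_single, Matrix.single_apply, Pi.single_apply, eq_comm]
    · simp [L, P, Matrix.transpose_single, h, Ne.symm h]

theorem lie_P_P (μ ν : Fin n) : ⁅(P μ : IGL n), P ν⁆ = 0 := by
  ext1
  · simp [P]
  · ext i; simp [P]

end IGL

/-! ### Enveloping algebras with the primitive coproduct -/

section Enveloping

attribute [local instance 100] LieRing.ofAssociativeRing

variable (𝔤 : Type) [LieRing 𝔤] [LieAlgebra ℂ 𝔤]

/-- `u ↦ u ⊗ 1 + 1 ⊗ u` on `𝔤`. -/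
def primitive : 𝔤 →ₗ⁅ℂ⁆
    (UniversalEnvelopingAlgebra ℂ 𝔤 ⊗[ℂ] UniversalEnvelopingAlgebra ℂ 𝔤) where
  toFun u := UniversalEnvelopingAlgebra.ι ℂ u ⊗ₜ 1 + 1 ⊗ₜ UniversalEnvelopingAlgebra.ι ℂ u
  map_add' x y := by
    simp only [map_add, TensorProduct.add_tmul, TensorProduct.tmul_add]; abel
  map_smul' c x := by
    simp only [map_smul, TensorProduct.smul_tmul', TensorProduct.tmul_smul, smul_add,
      RingHom.id_apply]
  map_lie' := by
    intro x y
    simp only [LieHom.map_lie, LieRing.of_associative_ring_bracket, TensorProduct.sub_tmul,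
      TensorProduct.tmul_sub, mul_add, add_mul, Algebra.TensorProduct.tmul_mul_tmul, one_mul,
      mul_one]
    abel

/-- The coproduct of `U(𝔤)`: the algebra homomorphism with `Δ(u) = u ⊗ 1 + 1 ⊗ u` on `𝔤`. -/
def envComul : UniversalEnvelopingAlgebra ℂ 𝔤 →ₐ[ℂ]
    UniversalEnvelopingAlgebra ℂ 𝔤 ⊗[ℂ] UniversalEnvelopingAlgebra ℂ 𝔤 :=
  UniversalEnvelopingAlgebra.lift ℂ (primitive 𝔤)

/-- The counit of `U(𝔤)`: the algebra homomorphism with `ε(u) = 0` on `𝔤`. -/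
def envCounit : UniversalEnvelopingAlgebra ℂ 𝔤 →ₐ[ℂ] ℂ :=
  UniversalEnvelopingAlgebra.lift ℂ (0 : 𝔤 →ₗ⁅ℂ⁆ ℂ)

theorem envComul_ι (u : 𝔤) : envComul 𝔤 (UniversalEnvelopingAlgebra.ι ℂ u) =
    UniversalEnvelopingAlgebra.ι ℂ u ⊗ₜ 1 + 1 ⊗ₜ UniversalEnvelopingAlgebra.ι ℂ u :=
  UniversalEnvelopingAlgebra.lift_ι_apply ℂ (primitive 𝔤) u

theorem envCounit_ι (u : 𝔤) : envCounit 𝔤 (UniversalEnvelopingAlgebra.ι ℂ u) = 0 :=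
  UniversalEnvelopingAlgebra.lift_ι_apply ℂ (0 : 𝔤 →ₗ⁅ℂ⁆ ℂ) u

instance envBialgebra : Bialgebra ℂ (UniversalEnvelopingAlgebra ℂ 𝔤) :=
  Bialgebra.ofAlgHom (envComul 𝔤) (envCounit 𝔤)
    (by
      apply UniversalEnvelopingAlgebra.hom_ext
      ext u
      simp [-UniversalEnvelopingAlgebra.ι_apply, envComul_ι, TensorProduct.add_tmul,
        TensorProduct.tmul_add, Algebra.TensorProduct.one_def, add_assoc])
    (by
      have h : ((Algebra.TensorProduct.lid ℂ (UniversalEnvelopingAlgebra ℂ 𝔤)).toAlgHom.comp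
          ((Algebra.TensorProduct.map (envCounit 𝔤) (AlgHom.id ℂ _)).comp (envComul 𝔤))) =
            AlgHom.id ℂ _ := by
        apply UniversalEnvelopingAlgebra.hom_ext
        apply LieHom.ext
        intro u
        simp [-UniversalEnvelopingAlgebra.ι_apply, envComul_ι, envCounit_ι]
      refine AlgHom.ext fun a => (Algebra.TensorProduct.lid ℂ _).injective ?_
      refine (DFunLike.congr_fun h a).trans ?_
      exact ((Algebra.TensorProduct.lid ℂ _).apply_symm_apply a).symm)
    (by
      apply UniversalEnvelopingAlgebra.hom_ext
      apply LieHom.ext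
      intro u
      simp [-UniversalEnvelopingAlgebra.ι_apply, envComul_ι, envCounit_ι])

end Enveloping

/-- The bialgebra `U(𝔦𝔤𝔩(n))`. -/
abbrev UIGL (n : ℕ) : Type := UniversalEnvelopingAlgebra ℂ (IGL n)

/-- The polynomial algebra `𝔛ⁿ = ℂ[x⁰, …, xⁿ⁻¹]`. -/
abbrev Coord (n : ℕ) : Type := MvPolynomial (Fin n) ℂ

section Action

attribute [local instance 100] LieRing.ofAssociativeRing

/-- The vector field by which an element of `𝔦𝔤𝔩(n)` acts: the derivation of `𝔛ⁿ` determined by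
`P_μ ▷ x^ρ = -i δ^ρ_μ` and `L^μ_ν ▷ x^ρ = -i δ^ρ_ν x^μ`. -/
def iglDerivation {n : ℕ} (u : IGL n) : Derivation ℂ (Coord n) (Coord n) :=
  MvPolynomial.mkDerivation ℂ fun ρ =>
    (-Complex.I) • (∑ μ, u.gl μ ρ • MvPolynomial.X μ + MvPolynomial.C (u.tr ρ))

theorem iglDerivation_X {n : ℕ} (u : IGL n) (ρ : Fin n) :
    iglDerivation u (MvPolynomial.X ρ) =
      (-Complex.I) • (∑ μ, u.gl μ ρ • MvPolynomial.X μ + MvPolynomial.C (u.tr ρ)) :=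
  MvPolynomial.mkDerivation_X _ _ _

theorem iglDerivation_comp_X {n : ℕ} (x y : IGL n) (ρ : Fin n) :
    iglDerivation x (iglDerivation y (MvPolynomial.X ρ)) =
      -(∑ σ, (x.gl * y.gl) σ ρ • MvPolynomial.X σ)
        - MvPolynomial.C (Matrix.mulVec y.gl.transpose x.tr ρ) := by
  have hC : ∀ c : ℂ, iglDerivation x (MvPolynomial.C c : Coord n) = 0 := fun c =>
    (iglDerivation x).map_algebraMap c
  have hI : (MvPolynomial.C Complex.I * MvPolynomial.C Complex.I : Coord n) = -1 := by
    rw [← map_mul, Complex.I_mul_I, map_neg, map_one]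
  rw [iglDerivation_X]
  simp only [Derivation.map_smul, map_add, map_sum, hC, add_zero, iglDerivation_X]
  simp only [MvPolynomial.smul_eq_C_mul, Matrix.mul_apply, Matrix.mulVec, dotProduct,
    Matrix.transpose_apply, map_sum, map_mul, map_neg, Finset.mul_sum, Finset.sum_mul, mul_add,
    Finset.sum_add_distrib, sub_eq_add_neg, ← Finset.sum_neg_distrib]
  rw [Finset.sum_comm]
  congr 1
  · refine Finset.sum_congr rfl fun σ _ => Finset.sum_congr rfl fun μ _ => ?_
    linear_combination MvPolynomial.C (x.gl σ μ) * MvPolynomial.C (y.gl μ ρ) *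
      MvPolynomial.X σ * hI
  · refine Finset.sum_congr rfl fun μ _ => ?_
    linear_combination MvPolynomial.C (x.tr μ) * MvPolynomial.C (y.gl μ ρ) * hI

/-- The resulting Lie algebra homomorphism from `𝔦𝔤𝔩(n)` to the linear endomorphisms of `𝔛ⁿ`. -/
def iglLieAction (n : ℕ) : IGL n →ₗ⁅ℂ⁆ Module.End ℂ (Coord n) where
  toFun u := (iglDerivation u : Coord n →ₗ[ℂ] Coord n)
  map_add' x y := by
    have h : iglDerivation (x + y) = iglDerivation x + iglDerivation y := by
      apply MvPolynomial.derivation_ext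
      intro ρ
      simp only [Derivation.add_apply, iglDerivation_X, IGL.add_gl, IGL.add_tr, Matrix.add_apply,
        Pi.add_apply, add_smul, Finset.sum_add_distrib, map_add, ← smul_add]
      congr 1; abel
    rw [h]; rfl
  map_smul' c x := by
    have h : iglDerivation (c • x) = c • iglDerivation x := by
      apply MvPolynomial.derivation_ext
      intro ρ
      simp only [Derivation.smul_apply, iglDerivation_X, IGL.smul_gl, IGL.smul_tr,
        Matrix.smul_apply, Pi.smul_apply]
      rw [smul_comm c]
      congr 1
      simp only [smul_add, Finset.smul_sum, MvPolynomial.smul_eq_C_mul, smul_eq_mul,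
        map_mul, mul_assoc]
    rw [h]; rfl
  map_lie' := by
    intro x y
    have h : iglDerivation ⁅x, y⁆ = ⁅iglDerivation x, iglDerivation y⁆ := by
      apply MvPolynomial.derivation_ext
      intro ρ
      rw [Derivation.commutator_apply, iglDerivation_comp_X, iglDerivation_comp_X,
        iglDerivation_X, IGL.lie_gl, IGL.lie_tr]
      simp only [Matrix.smul_apply, Matrix.sub_apply, Pi.smul_apply, Pi.sub_apply, smul_add,
        MvPolynomial.smul_eq_C_mul, smul_eq_mul, map_mul, map_sub, map_neg,
        sub_mul, mul_sub, Finset.sum_sub_distrib, Finset.mul_sum]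
      have hI : (MvPolynomial.C Complex.I * MvPolynomial.C Complex.I : Coord n) = -1 := by
        rw [← map_mul, Complex.I_mul_I, map_neg, map_one]
      simp only [← mul_assoc, neg_mul, mul_neg, hI, neg_neg, one_mul, Finset.sum_neg_distrib]
      ring
    rw [h]; exact Derivation.commutator_coe_linear_map

/-- The action `▷` of `U(𝔦𝔤𝔩(n))` on `𝔛ⁿ`. -/
def iglAction (n : ℕ) : UIGL n →ₐ[ℂ] Module.End ℂ (Coord n) :=
  UniversalEnvelopingAlgebra.lift ℂ (iglLieAction n)

theorem iglAction_ι {n : ℕ} (u : IGL n) (f : Coord n) :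
    iglAction n (UniversalEnvelopingAlgebra.ι ℂ u) f = iglDerivation u f := by
  rw [iglAction, UniversalEnvelopingAlgebra.lift_ι_apply]; rfl

end Action

theorem iglAction_P {n : ℕ} (μ ρ : Fin n) :
    iglAction n (UniversalEnvelopingAlgebra.ι ℂ (IGL.P μ)) (MvPolynomial.X ρ) =
      MvPolynomial.C (-Complex.I * if ρ = μ then 1 else 0) := by
  rw [iglAction_ι, iglDerivation_X]
  by_cases h : ρ = μ <;> simp [IGL.P, MvPolynomial.smul_eq_C_mul, h]

theorem iglAction_L {n : ℕ} (μ ν ρ : Fin n) :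
    iglAction n (UniversalEnvelopingAlgebra.ι ℂ (IGL.L μ ν)) (MvPolynomial.X ρ) =
      (-Complex.I * if ρ = ν then 1 else 0) • MvPolynomial.X μ := by
  rw [iglAction_ι, iglDerivation_X]
  by_cases h : ρ = ν
  · simp [IGL.L, Matrix.single_apply, h]
  · simp [IGL.L, h, Ne.symm h]

/-! ### `h`-adic modules and maps

For a complex vector space `V`, `V⟦X⟧` is the `h`-adic module `V[[h]]` (the variable `X` is `h`).
The completed tensor product of `V[[h]]` and `W[[h]]` is `(V ⊗ W)[[h]]`. -/

section HAdic

variable {V W : Type*} [Ring V] [Algebra ℂ V] [Ring W] [Algebra ℂ W]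

/-- `V[[h]]` as a `ℂ[[h]]`-algebra (Cauchy product), for an algebra `V` that need not be
commutative. -/
instance hAdicAlgebra (V : Type*) [Ring V] [Algebra ℂ V] : Algebra ℂ⟦X⟧ V⟦X⟧ :=
  (PowerSeries.map (algebraMap ℂ V)).toAlgebra' fun c x => by
    ext n
    simp only [PowerSeries.coeff_mul, PowerSeries.coeff_map]
    rw [← Finset.Nat.sum_antidiagonal_swap]
    exact Finset.sum_congr rfl fun p _ => Algebra.commutes _ _

theorem coeff_hAdic_smul (c : ℂ⟦X⟧) (v : V⟦X⟧) (n : ℕ) :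
    PowerSeries.coeff n (c • v) = ∑ p ∈ Finset.HasAntidiagonal.antidiagonal n,
      PowerSeries.coeff p.1 c • PowerSeries.coeff p.2 v := by
  rw [Algebra.smul_def]
  change PowerSeries.coeff n (PowerSeries.map (algebraMap ℂ V) c * v) = _
  simp only [PowerSeries.coeff_mul, PowerSeries.coeff_map, Algebra.smul_def]

/-- The pure tensor `v ⊗ w ∈ (V ⊗ W)[[h]]` of `v ∈ V[[h]]` and `w ∈ W[[h]]`:
its coefficient of `hⁿ` is `∑_{i+j=n} vᵢ ⊗ wⱼ`. -/
def hTensor (v : V⟦X⟧) (w : W⟦X⟧) : (V ⊗[ℂ] W)⟦X⟧ :=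
  PowerSeries.mk fun n => ∑ p ∈ Finset.HasAntidiagonal.antidiagonal n,
    PowerSeries.coeff p.1 v ⊗ₜ[ℂ] PowerSeries.coeff p.2 w

variable (V W) in
/-- A `ℂ[[h]]`-linear map `V[[h]] → W[[h]]`, written as the series `∑ hᵏ Tₖ` of its
coefficients, which are `ℂ`-linear maps `Tₖ : V → W`. -/
def HMap : Type _ := ℕ → V →ₗ[ℂ] W

/-- The `ℂ[[h]]`-linear map `∑ hᵏ Tₖ`: the coefficient of `hⁿ` in `T v` is `∑_{i+j=n} Tᵢ vⱼ`. -/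
def HMap.toLinear (T : HMap V W) : V⟦X⟧ →ₗ[ℂ⟦X⟧] W⟦X⟧ where
  toFun v := PowerSeries.mk fun n => ∑ p ∈ Finset.HasAntidiagonal.antidiagonal n, T p.1 (PowerSeries.coeff p.2 v)
  map_add' v w := by
    ext n
    simp [Finset.sum_add_distrib]
  map_smul' c v := by
    ext n
    simp only [RingHom.id_apply, coeff_hAdic_smul, PowerSeries.coeff_mk, map_sum, map_smul,
      Finset.smul_sum]
    simp only [Finset.sum_sigma']
    refine Finset.sum_bij' (fun x _ => ⟨(x.2.1, x.1.1 + x.2.2), (x.1.1, x.2.2)⟩)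
      (fun x _ => ⟨(x.2.1, x.1.1 + x.2.2), (x.1.1, x.2.2)⟩) ?_ ?_ ?_ ?_ ?_ <;>
      simp only [Finset.mem_sigma, Finset.HasAntidiagonal.mem_antidiagonal, Sigma.forall, Prod.forall] <;>
      rintro a b c d ⟨h₁, h₂⟩ <;> subst h₁ <;> subst h₂ <;> simp [add_left_comm]

/-- The `ℂ[[h]]`-linear extension of a `ℂ`-linear map. -/
def HMap.const (f : V →ₗ[ℂ] W) : HMap V W := fun k => if k = 0 then f else 0

end HAdic

/-! ### Smash products -/

section Smash

variable {A H : Type*} [Ring A] [Algebra ℂ A] [Ring H] [Algebra ℂ H]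

/-- For linear maps `m : A ⊗ A → A` and `δ : H → H ⊗ H`, `δ(L) = L₍₁₎ ⊗ L₍₂₎`, and an action `▷`
of `H` on `A`, the map `(f ⊗ L) ⊗ (g ⊗ M) ↦ m(f ⊗ (L₍₁₎ ▷ g)) ⊗ L₍₂₎ M`. -/
def smashCore (act : H →ₐ[ℂ] Module.End ℂ A) (m : A ⊗[ℂ] A →ₗ[ℂ] A) (δ : H →ₗ[ℂ] H ⊗[ℂ] H) :
    (A ⊗[ℂ] H) ⊗[ℂ] (A ⊗[ℂ] H) →ₗ[ℂ] A ⊗[ℂ] H :=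
  LinearMap.rTensor H m ∘ₗ
    (TensorProduct.assoc ℂ A A H).symm.toLinearMap ∘ₗ
    LinearMap.lTensor A
      (TensorProduct.map (TensorProduct.lift act.toLinearMap) (LinearMap.mul' ℂ H)) ∘ₗ
    LinearMap.lTensor A (TensorProduct.tensorTensorTensorComm ℂ H H A H).toLinearMap ∘ₗ
    (TensorProduct.assoc ℂ A (H ⊗[ℂ] H) (A ⊗[ℂ] H)).toLinearMap ∘ₗ
    LinearMap.rTensor (A ⊗[ℂ] H) (LinearMap.lTensor A δ)

theorem smashCore_tmul (act : H →ₐ[ℂ] Module.End ℂ A) (m : A ⊗[ℂ] A →ₗ[ℂ] A)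
    (δ : H →ₗ[ℂ] H ⊗[ℂ] H) (f g : A) (L M : H) {ι : Type*} (s : Finset ι) (L₁ L₂ : ι → H)
    (h : δ L = ∑ i ∈ s, L₁ i ⊗ₜ[ℂ] L₂ i) :
    smashCore act m δ ((f ⊗ₜ L) ⊗ₜ (g ⊗ₜ M)) =
      ∑ i ∈ s, m (f ⊗ₜ act (L₁ i) g) ⊗ₜ[ℂ] (L₂ i * M) := by
  simp [smashCore, h, TensorProduct.tmul_sum, TensorProduct.sum_tmul]

/-- The `ℂ[[h]]`-linear version of `smashCore`, for `m = ∑ hⁱ mᵢ` and `δ = ∑ hʲ δⱼ`. -/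
def smashMap (act : H →ₐ[ℂ] Module.End ℂ A) (m : HMap (A ⊗[ℂ] A) A) (δ : HMap H (H ⊗[ℂ] H)) :
    HMap ((A ⊗[ℂ] H) ⊗[ℂ] (A ⊗[ℂ] H)) (A ⊗[ℂ] H) :=
  fun k => ∑ p ∈ Finset.HasAntidiagonal.antidiagonal k, smashCore act (m p.1) (δ p.2)

/-- The smash product `A[[h]] ⋊ H[[h]]`, where the multiplication of `A[[h]]` is `m`, the coproduct
of `H[[h]]` is `δ`, and the action and the multiplication of `H[[h]]` are the
`ℂ[[h]]`-linear extensions of those of `H`. The underlying `ℂ[[h]]`-module is `(A ⊗ H)[[h]]`. -/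
@[nolint unusedArguments]
def SmashProduct (_act : H →ₐ[ℂ] Module.End ℂ A) (_m : HMap (A ⊗[ℂ] A) A)
    (_δ : HMap H (H ⊗[ℂ] H)) : Type _ :=
  (A ⊗[ℂ] H)⟦X⟧

namespace SmashProduct

variable {act : H →ₐ[ℂ] Module.End ℂ A} {m : HMap (A ⊗[ℂ] A) A} {δ : HMap H (H ⊗[ℂ] H)}

instance : AddCommGroup (SmashProduct act m δ) := inferInstanceAs (AddCommGroup (A ⊗[ℂ] H)⟦X⟧)

instance : Module ℂ⟦X⟧ (SmashProduct act m δ) := inferInstanceAs (Module ℂ⟦X⟧ (A ⊗[ℂ] H)⟦X⟧)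

variable (act m δ) in
/-- The identification of the underlying module with `(A ⊗ H)[[h]]`. -/
def ofSeries : (A ⊗[ℂ] H)⟦X⟧ ≃ₗ[ℂ⟦X⟧] SmashProduct act m δ :=
  LinearEquiv.refl ℂ⟦X⟧ (A ⊗[ℂ] H)⟦X⟧

/-- The underlying element of `(A ⊗ H)[[h]]`. -/
def series (a : SmashProduct act m δ) : (A ⊗[ℂ] H)⟦X⟧ := (ofSeries act m δ).symm a

/-- `(f ⊗ L) # (g ⊗ M) = m(f ⊗ (L₍₁₎ ▷ g)) ⊗ L₍₂₎ M`, extended `ℂ[[h]]`-bilinearly and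
`h`-adically continuously. -/
instance : Mul (SmashProduct act m δ) where
  mul a b := ofSeries act m δ ((smashMap act m δ).toLinear (hTensor a.series b.series))

/-- The unit is `1 ⊗ 1`. -/
instance : One (SmashProduct act m δ) where
  one := ofSeries act m δ (hTensor 1 1)

/-- The embedding `f ↦ f ⊗ 1` of `A[[h]]`. -/
def inl (f : A⟦X⟧) : SmashProduct act m δ := ofSeries act m δ (hTensor f 1)

/-- The embedding `L ↦ 1 ⊗ L` of `H[[h]]`. -/
def inr (L : H⟦X⟧) : SmashProduct act m δ := ofSeries act m δ (hTensor 1 L)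

end SmashProduct

/-- A `ℂ[[h]]`-module with a multiplication and a distinguished element is a unital associative
`ℂ[[h]]`-algebra. -/
structure IsUnitalAssocAlgebra (S : Type*) [AddCommGroup S] [Module ℂ⟦X⟧ S] [Mul S] [One S] :
    Prop where
  add_mul : ∀ a b c : S, (a + b) * c = a * c + b * c
  mul_add : ∀ a b c : S, a * (b + c) = a * b + a * c
  smul_mul : ∀ (t : ℂ⟦X⟧) (a b : S), (t • a) * b = t • (a * b)
  mul_smul : ∀ (t : ℂ⟦X⟧) (a b : S), a * (t • b) = t • (a * b)
  mul_assoc : ∀ a b c : S, a * b * c = a * (b * c)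
  one_mul : ∀ a : S, 1 * a = a
  mul_one : ∀ a : S, a * 1 = a

end Smash

/-! ### Drinfeld twists -/

section Twist

variable (H : Type*) [Ring H] [Bialgebra ℂ H]

/-- A Drinfeld twist of `H[[h]]`: an invertible `F ∈ (H ⊗ H)[[h]]` with `F = 1 ⊗ 1 + O(h)`, the
`2`-cocycle condition `F₁₂ (Δ ⊗ id)F = F₂₃ (id ⊗ Δ)F` and the normalization
`(ε ⊗ id)F = 1 = (id ⊗ ε)F`. -/
structure DrinfeldTwist where
  F : ((H ⊗[ℂ] H)⟦X⟧)ˣ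
  coeff_zero : PowerSeries.coeff 0 (F : (H ⊗[ℂ] H)⟦X⟧) = 1
  cocycle :
    PowerSeries.map (Algebra.TensorProduct.assoc ℂ ℂ ℂ H H H : (H ⊗[ℂ] H) ⊗[ℂ] H →+* _)
        (PowerSeries.map (Algebra.TensorProduct.includeLeft :
              H ⊗[ℂ] H →ₐ[ℂ] (H ⊗[ℂ] H) ⊗[ℂ] H).toRingHom F *
          PowerSeries.map (Algebra.TensorProduct.map (Bialgebra.comulAlgHom ℂ H)
              (AlgHom.id ℂ H)).toRingHom F) =
      PowerSeries.map (Algebra.TensorProduct.includeRight :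
            H ⊗[ℂ] H →ₐ[ℂ] H ⊗[ℂ] (H ⊗[ℂ] H)).toRingHom F *
        PowerSeries.map (Algebra.TensorProduct.map (AlgHom.id ℂ H)
            (Bialgebra.comulAlgHom ℂ H)).toRingHom F
  counit_left :
    PowerSeries.map ((Algebra.TensorProduct.lid ℂ H).toAlgHom.comp
      (Algebra.TensorProduct.map (Bialgebra.counitAlgHom ℂ H) (AlgHom.id ℂ H))).toRingHom F = 1
  counit_right :
    PowerSeries.map ((Algebra.TensorProduct.rid ℂ ℂ H).toAlgHom.comp
      (Algebra.TensorProduct.map (AlgHom.id ℂ H) (Bialgebra.counitAlgHom ℂ H))).toRingHom F = 1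

variable {H}

namespace DrinfeldTwist

variable (T : DrinfeldTwist H)

/-- The inverse twist `F⁻¹ ∈ (H ⊗ H)[[h]]`. -/
def inv : (H ⊗[ℂ] H)⟦X⟧ := ((T.F⁻¹ : ((H ⊗[ℂ] H)⟦X⟧)ˣ) : (H ⊗[ℂ] H)⟦X⟧)

/-- The twisted coproduct `Δ^F(L) = F Δ(L) F⁻¹`, given by its values on `L ∈ H`. -/
def comul : HMap H (H ⊗[ℂ] H) := fun k =>
  { toFun := fun L => PowerSeries.coeff k
      ((T.F : (H ⊗[ℂ] H)⟦X⟧) * PowerSeries.C (CoalgebraStruct.comul (R := ℂ) L) * T.inv)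
    map_add' := fun L M => by simp only [map_add, mul_add, add_mul]
    map_smul' := fun c L => by
      simp only [map_smul, PowerSeries.coeff_mul, PowerSeries.coeff_C, mul_ite, mul_zero,
        mul_smul_comm, smul_mul_assoc, Finset.smul_sum, Finset.sum_mul, ite_mul, zero_mul,
        smul_ite, smul_zero, RingHom.id_apply] }

variable {A : Type*} [Ring A] [Algebra ℂ A] (act : H →ₐ[ℂ] Module.End ℂ A)

/-- The star product `f ⋆ g = m(F⁻¹ ▷ (f ⊗ g))` on `A[[h]]`. -/
def star : HMap (A ⊗[ℂ] A) A := fun k =>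
  LinearMap.mul' ℂ A ∘ₗ
    TensorProduct.homTensorHomMap (RingHom.id ℂ) A A A A
      (TensorProduct.map act.toLinearMap act.toLinearMap (PowerSeries.coeff k T.inv))

/-- The map `f ↦ f̂ = ∑ (f̄^α ▷ f) ⊗ f̄_α`, where `F⁻¹ = ∑ f̄^α ⊗ f̄_α`, from `A[[h]]` to
`(A ⊗ H)[[h]]`. -/
def hat : HMap A (A ⊗[ℂ] H) := fun k =>
  { toFun := fun f =>
      LinearMap.rTensor H (act.toLinearMap.flip f) (PowerSeries.coeff k T.inv)
    map_add' := fun f g => by simp only [map_add, LinearMap.rTensor_add, LinearMap.add_apply]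
    map_smul' := fun c f => by
      simp only [map_smul, LinearMap.rTensor_smul, LinearMap.smul_apply, RingHom.id_apply] }

end DrinfeldTwist

end Twist

/-! ### The two algebras of the result -/

/-- The smash product `𝔛ⁿ[[h]] ⋊ U(𝔦𝔤𝔩(n))[[h]]`. -/
abbrev IGLSmash (n : ℕ) : Type :=
  SmashProduct (iglAction n) (HMap.const (LinearMap.mul' ℂ (Coord n)))
    (HMap.const (CoalgebraStruct.comul (R := ℂ) (A := UIGL n)))

/-- The twisted smash product `𝔛ⁿ[[h]]^F ⋊ (U(𝔦𝔤𝔩(n))[[h]])^F`. -/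
abbrev TwistedIGLSmash {n : ℕ} (T : DrinfeldTwist (UIGL n)) : Type :=
  SmashProduct (iglAction n) (T.star (iglAction n)) T.comul

end TwistSmash

end

open TwistSmash

/-! Let `H` be a bialgebra and `A` an `H`-module algebra. The algebra `H ⊗ H` acts on `A ⊗ H` by `(P
⊗ Q)(f ⊗ L) = (P ▷ f) ⊗ Q L`. The isomorphism is the action of `F⁻¹`, that is `f ⊗ L ↦ (f̄^α ▷ f) ⊗
f̄_α L`; the action of `F` inverts it.

Multiplicativity becomes an identity in `(H ⊗ H ⊗ H)[[h]]`. Both `φ(a b)` and `φ(a) φ(b)`, for `a =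
f ⊗ L` and `b = g ⊗ M`, arise by applying `P ⊗ Q ⊗ R ↦ (P ▷ f)(Q ▷ g) ⊗ R M` (`tripleAct`) to a
series. For `φ(a b)` it is `(Δ ⊗ id)(F⁻¹) F⁻¹₁₂ F₂₃ Δ(L)₂₃ F⁻¹₂₃`; for `φ(a) φ(b)` it is `(id ⊗
Δ)(F⁻¹) Δ(L)₂₃ F⁻¹₂₃`. The inverted cocycle condition `cocycle_inv` makes them equal
(`untwist_mulBilin`).

Normalization gives `φ(1 ⊗ L) = 1 ⊗ L`, and `F⁻¹ = 1 ⊗ 1 + O(h)` gives the congruence modulo `h`.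
Associativity and the unit laws are checked for the undeformed product and pulled back along `φ` to
the twisted one. The Lie algebra `𝔦𝔤𝔩(n)` enters only through `iglAction_isModuleAlgebra`. -/

noncomputable section

namespace TwistSmash

/-! ### Linear and bilinear maps of `h`-adic modules, reduced to constants. -/

section HAdic

variable {V W Z : Type*} [Ring V] [Algebra ℂ V] [Ring W] [Algebra ℂ W] [Ring Z] [Algebra ℂ Z]

theorem hAdic_X_smul (v : V⟦X⟧) : (PowerSeries.X : ℂ⟦X⟧) • v = PowerSeries.X * v := by
  rw [Algebra.smul_def]
  change PowerSeries.map (algebraMap ℂ V) PowerSeries.X * v = _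
  rw [PowerSeries.map_X]

/-- A `ℂ[[h]]`-linear map between `h`-adic modules is determined by its values on constants. -/
theorem hAdic_linearMap_ext {S T : V⟦X⟧ →ₗ[ℂ⟦X⟧] W⟦X⟧}
    (h : ∀ v : V, S (PowerSeries.C v) = T (PowerSeries.C v)) : S = T := by
  have split : ∀ v : V⟦X⟧, v =
      (PowerSeries.X : ℂ⟦X⟧) • PowerSeries.mk (fun i => PowerSeries.coeff (i + 1) v)
        + PowerSeries.C (PowerSeries.coeff 0 v) := fun v => by
    rw [hAdic_X_smul]
    simpa using PowerSeries.eq_X_mul_shift_add_const v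
  -- Linearity over `ℂ[[h]]` suffices, without a continuity assumption: since `v = h v' + v₀` and `D
  -- v₀ = 0`, one has `D v = h D v'`, so coefficient `k + 1` of `D v` is coefficient `k` of `D v'`.
  have key : ∀ D : V⟦X⟧ →ₗ[ℂ⟦X⟧] W⟦X⟧, (∀ v : V, D (PowerSeries.C v) = 0) →
      ∀ (k : ℕ) (v : V⟦X⟧), PowerSeries.coeff k (D v) = 0 := by
    intro D hD k
    induction k with
    | zero =>
      intro v
      rw [split v, map_add, hD, map_smul, add_zero, hAdic_X_smul, PowerSeries.coeff_zero_X_mul]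
    | succ k ih =>
      intro v
      rw [split v, map_add, hD, map_smul, add_zero, hAdic_X_smul, PowerSeries.coeff_succ_X_mul]
      exact ih _
  ext v k
  have := key (S - T) (fun v => by simp [h]) k v
  simpa [sub_eq_zero] using this

theorem hAdic_bilin_ext {S T : V⟦X⟧ →ₗ[ℂ⟦X⟧] W⟦X⟧ →ₗ[ℂ⟦X⟧] Z⟦X⟧}
    (h : ∀ (v : V) (w : W), S (PowerSeries.C v) (PowerSeries.C w) =
      T (PowerSeries.C v) (PowerSeries.C w)) : S = T := by
  refine LinearMap.ext fun v => LinearMap.ext fun w => ?_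
  refine LinearMap.congr_fun (f := S.flip w) (g := T.flip w) (hAdic_linearMap_ext fun v => ?_) v
  exact LinearMap.congr_fun (hAdic_linearMap_ext (h v)) w

theorem map_hAdic_smul (f : V →ₐ[ℂ] W) (c : ℂ⟦X⟧) (v : V⟦X⟧) :
    PowerSeries.map f.toRingHom (c • v) = c • PowerSeries.map f.toRingHom v := by
  ext k
  simp [coeff_hAdic_smul]

/-- With the Cauchy sum written as a product in the ring `(V ⊗ W)[[h]]`, bilinearity of `hTensor`
follows from the ring laws. -/
theorem hTensor_eq_mul (v : V⟦X⟧) (w : W⟦X⟧) :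
    hTensor v w =
      PowerSeries.map (Algebra.TensorProduct.includeLeft : V →ₐ[ℂ] V ⊗[ℂ] W).toRingHom v *
        PowerSeries.map (Algebra.TensorProduct.includeRight : W →ₐ[ℂ] V ⊗[ℂ] W).toRingHom w := by
  ext k
  simp [hTensor, PowerSeries.coeff_mul]

/-- The pure tensor as a `ℂ[[h]]`-bilinear map. -/
def hTensorBilin (V W : Type*) [Ring V] [Algebra ℂ V] [Ring W] [Algebra ℂ W] :
    V⟦X⟧ →ₗ[ℂ⟦X⟧] W⟦X⟧ →ₗ[ℂ⟦X⟧] (V ⊗[ℂ] W)⟦X⟧ :=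
  LinearMap.mk₂ ℂ⟦X⟧ hTensor
    (fun v v' w => by simp only [hTensor_eq_mul, map_add, add_mul])
    (fun c v w => by rw [hTensor_eq_mul, hTensor_eq_mul, map_hAdic_smul, smul_mul_assoc])
    (fun v w w' => by simp only [hTensor_eq_mul, map_add, mul_add])
    (fun c v w => by rw [hTensor_eq_mul, hTensor_eq_mul, map_hAdic_smul, mul_smul_comm])

theorem hTensorBilin_apply (v : V⟦X⟧) (w : W⟦X⟧) : hTensorBilin V W v w = hTensor v w := rfl

theorem hTensor_C (v : V) (w : W) :
    hTensor (PowerSeries.C v) (PowerSeries.C w) = PowerSeries.C (v ⊗ₜ[ℂ] w) := by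
  rw [hTensor_eq_mul, PowerSeries.map_C, PowerSeries.map_C, ← map_mul]
  simp

theorem HMap.coeff_toLinear (T : HMap V W) (v : V⟦X⟧) (k : ℕ) :
    PowerSeries.coeff k (T.toLinear v) =
      ∑ p ∈ Finset.HasAntidiagonal.antidiagonal k, T p.1 (PowerSeries.coeff p.2 v) :=
  PowerSeries.coeff_mk k fun k =>
    ∑ p ∈ Finset.HasAntidiagonal.antidiagonal k, T p.1 (PowerSeries.coeff p.2 v)

theorem HMap.coeff_toLinear_C (T : HMap V W) (v : V) (k : ℕ) :
    PowerSeries.coeff k (T.toLinear (PowerSeries.C v)) = T k v := by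
  rw [HMap.coeff_toLinear, Finset.sum_eq_single (k, 0)]
  · simp
  · rintro ⟨i, j⟩ hp hne
    have : j ≠ 0 := by
      rintro rfl
      exact hne (by simpa using hp)
    simp [PowerSeries.coeff_C, this]
  · simp

theorem HMap.const_zero (f : V →ₗ[ℂ] W) : HMap.const f 0 = f := rfl

theorem HMap.const_of_ne_zero (f : V →ₗ[ℂ] W) {k : ℕ} (hk : k ≠ 0) : HMap.const f k = 0 :=
  if_neg hk

theorem HMap.coeff_const_toLinear (f : V →ₗ[ℂ] W) (v : V⟦X⟧) (k : ℕ) :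
    PowerSeries.coeff k ((HMap.const f).toLinear v) = f (PowerSeries.coeff k v) := by
  rw [HMap.coeff_toLinear, Finset.sum_eq_single (0, k)]
  · rfl
  · rintro ⟨i, j⟩ hp hne
    have : i ≠ 0 := by
      rintro rfl
      exact hne (by simpa using hp)
    simp [HMap.const_of_ne_zero f this]
  · simp

end HAdic

/-! ### The smash product as a bilinear operation on series. -/

section Smash

variable {A H : Type*} [Ring A] [Algebra ℂ A] [Ring H] [Algebra ℂ H]

namespace SmashProduct

variable (act : H →ₐ[ℂ] Module.End ℂ A) (m : HMap (A ⊗[ℂ] A) A) (δ : HMap H (H ⊗[ℂ] H))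

/-- The product of a smash product as a `ℂ[[h]]`-bilinear map on `(A ⊗ H)[[h]]`. -/
def mulBilin : (A ⊗[ℂ] H)⟦X⟧ →ₗ[ℂ⟦X⟧] (A ⊗[ℂ] H)⟦X⟧ →ₗ[ℂ⟦X⟧] (A ⊗[ℂ] H)⟦X⟧ :=
  (hTensorBilin (A ⊗[ℂ] H) (A ⊗[ℂ] H)).compr₂ (smashMap act m δ).toLinear

theorem coeff_mulBilin_C (x y : A ⊗[ℂ] H) (k : ℕ) :
    PowerSeries.coeff k (mulBilin act m δ (PowerSeries.C x) (PowerSeries.C y)) =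
      smashMap act m δ k (x ⊗ₜ y) := by
  change PowerSeries.coeff k ((smashMap act m δ).toLinear (hTensor _ _)) = _
  rw [hTensor_C, HMap.coeff_toLinear_C]

theorem smashMap_const (μ : A ⊗[ℂ] A →ₗ[ℂ] A) (d : H →ₗ[ℂ] H ⊗[ℂ] H) :
    smashMap act (HMap.const μ) (HMap.const d) = HMap.const (smashCore act μ d) := by
  funext k
  by_cases hk : k = 0
  · subst hk
    simp [smashMap, HMap.const_zero]
  · rw [HMap.const_of_ne_zero _ hk, smashMap]
    refine Finset.sum_eq_zero ?_
    rintro ⟨i, j⟩ hp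
    have : i ≠ 0 ∨ j ≠ 0 := by
      have := Finset.HasAntidiagonal.mem_antidiagonal.mp hp
      omega
    rcases this with h | h
    · simp [HMap.const_of_ne_zero _ h, smashCore]
    · simp [HMap.const_of_ne_zero _ h, smashCore]

theorem coeff_mulBilin_const (μ : A ⊗[ℂ] A →ₗ[ℂ] A) (d : H →ₗ[ℂ] H ⊗[ℂ] H)
    (a b : (A ⊗[ℂ] H)⟦X⟧) (k : ℕ) :
    PowerSeries.coeff k (mulBilin act (HMap.const μ) (HMap.const d) a b) =
      ∑ p ∈ Finset.HasAntidiagonal.antidiagonal k,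
        smashCore act μ d (PowerSeries.coeff p.1 a ⊗ₜ PowerSeries.coeff p.2 b) := by
  change PowerSeries.coeff k ((smashMap act _ _).toLinear (hTensor a b)) = _
  rw [smashMap_const, HMap.coeff_const_toLinear, hTensor, PowerSeries.coeff_mk, map_sum]

theorem mulBilin_const_C (μ : A ⊗[ℂ] A →ₗ[ℂ] A) (d : H →ₗ[ℂ] H ⊗[ℂ] H) (x y : A ⊗[ℂ] H) :
    mulBilin act (HMap.const μ) (HMap.const d) (PowerSeries.C x) (PowerSeries.C y) =
      PowerSeries.C (smashCore act μ d (x ⊗ₜ y)) := by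
  ext k
  rw [coeff_mulBilin_C, smashMap_const, PowerSeries.coeff_C, HMap.const]
  split_ifs <;> rfl

variable {act m δ}

/-- The product of a smash product is bilinear, so only associativity and the unit laws have to
be checked. -/
theorem isUnitalAssocAlgebra
    (hassoc : ∀ a b c : SmashProduct act m δ, a * b * c = a * (b * c))
    (hone_mul : ∀ a : SmashProduct act m δ, 1 * a = a)
    (hmul_one : ∀ a : SmashProduct act m δ, a * 1 = a) :
    IsUnitalAssocAlgebra (SmashProduct act m δ) where
  add_mul a b c := LinearMap.map_add₂ (mulBilin act m δ) a b c
  mul_add a b c := map_add (mulBilin act m δ a) b c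
  smul_mul t a b := LinearMap.map_smul₂ (mulBilin act m δ) t a b
  mul_smul t a b := map_smul (mulBilin act m δ a) t b
  mul_assoc := hassoc
  one_mul := hone_mul
  mul_one := hmul_one

theorem one_eq : (1 : SmashProduct act m δ) = (PowerSeries.C (1 : A ⊗[ℂ] H) : (A ⊗[ℂ] H)⟦X⟧) := by
  change hTensor 1 1 = _
  rw [← map_one (PowerSeries.C (R := A)), ← map_one (PowerSeries.C (R := H)), hTensor_C]
  rfl

end SmashProduct

end Smash

/-! ### The undeformed smash product of a module algebra. -/

section ModuleAlgebra

variable {A H : Type*} [Ring A] [Algebra ℂ A] [Ring H] [Bialgebra ℂ H]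

/-- The action makes `A` a module algebra over the bialgebra `H`:
`L ▷ (f g) = (L₍₁₎ ▷ f) (L₍₂₎ ▷ g)` and `L ▷ 1 = ε(L) 1`. -/
structure IsModuleAlgebra (act : H →ₐ[ℂ] Module.End ℂ A) : Prop where
  act_mul : ∀ (L : H) (f g : A), act L (f * g) = LinearMap.mul' ℂ A
    (TensorProduct.map (act.toLinearMap.flip f) (act.toLinearMap.flip g)
      (CoalgebraStruct.comul (R := ℂ) L))
  act_one : ∀ L : H, act L 1 = CoalgebraStruct.counit (R := ℂ) L • (1 : A)

variable (act : H →ₐ[ℂ] Module.End ℂ A)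

/-- `H ⊗ H` acts on `A ⊗ H` by `▷` on the first factor and left multiplication on the second. -/
def tensorAct : H ⊗[ℂ] H →ₐ[ℂ] Module.End ℂ (A ⊗[ℂ] H) :=
  (Module.endTensorEndAlgHom (R := ℂ) (S := ℂ) (A := ℂ) (M := A) (N := H)).comp
    (Algebra.TensorProduct.map act (Algebra.lmul ℂ H))

@[simp] theorem tensorAct_tmul (P Q L : H) (f : A) :
    tensorAct act (P ⊗ₜ Q) (f ⊗ₜ L) = act P f ⊗ₜ (Q * L) := by
  rw [tensorAct, AlgHom.comp_apply, Algebra.TensorProduct.map_tmul,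
    Module.endTensorEndAlgHom_apply, TensorProduct.AlgebraTensorModule.map_tmul]
  rfl

/-- The map `P ⊗ Q ⊗ R ↦ (P ▷ f) (Q ▷ g) ⊗ R M`. -/
def tripleAct (f g : A) (M : H) : H ⊗[ℂ] (H ⊗[ℂ] H) →ₗ[ℂ] A ⊗[ℂ] H :=
  LinearMap.rTensor H (LinearMap.mul' ℂ A) ∘ₗ
    (TensorProduct.assoc ℂ A A H).symm.toLinearMap ∘ₗ
    TensorProduct.map (act.toLinearMap.flip f)
      (TensorProduct.map (act.toLinearMap.flip g) (LinearMap.mulRight ℂ M))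

@[simp] theorem tripleAct_tmul (f g : A) (M P Q R : H) :
    tripleAct act f g M (P ⊗ₜ (Q ⊗ₜ R)) = (act P f * act Q g) ⊗ₜ (R * M) := by
  simp [tripleAct]

variable (H) in
/-- `X ↦ X ⊗ 1`. -/
def leg₁₂ : H ⊗[ℂ] H →ₐ[ℂ] H ⊗[ℂ] (H ⊗[ℂ] H) :=
  (Algebra.TensorProduct.assoc ℂ ℂ ℂ H H H).toAlgHom.comp Algebra.TensorProduct.includeLeft

variable (H) in
/-- `X ↦ 1 ⊗ X`. -/
def leg₂₃ : H ⊗[ℂ] H →ₐ[ℂ] H ⊗[ℂ] (H ⊗[ℂ] H) :=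
  Algebra.TensorProduct.includeRight

variable (H) in
/-- `Δ ⊗ id`. -/
def comulLeft : H ⊗[ℂ] H →ₐ[ℂ] H ⊗[ℂ] (H ⊗[ℂ] H) :=
  (Algebra.TensorProduct.assoc ℂ ℂ ℂ H H H).toAlgHom.comp
    (Algebra.TensorProduct.map (Bialgebra.comulAlgHom ℂ H) (AlgHom.id ℂ H))

variable (H) in
/-- `id ⊗ Δ`. -/
def comulRight : H ⊗[ℂ] H →ₐ[ℂ] H ⊗[ℂ] (H ⊗[ℂ] H) :=
  Algebra.TensorProduct.map (AlgHom.id ℂ H) (Bialgebra.comulAlgHom ℂ H)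

@[simp] theorem leg₁₂_tmul (P Q : H) : leg₁₂ H (P ⊗ₜ Q) = P ⊗ₜ (Q ⊗ₜ 1) := by
  simp [leg₁₂]

@[simp] theorem leg₂₃_apply (X : H ⊗[ℂ] H) : leg₂₃ H X = 1 ⊗ₜ X := rfl

@[simp] theorem comulLeft_tmul (P Q : H) :
    comulLeft H (P ⊗ₜ Q) =
      TensorProduct.assoc ℂ H H H (CoalgebraStruct.comul (R := ℂ) P ⊗ₜ Q) := by
  simp only [comulLeft, AlgHom.comp_apply, Algebra.TensorProduct.map_tmul]
  rfl

@[simp] theorem comulRight_tmul (P Q : H) :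
    comulRight H (P ⊗ₜ Q) = P ⊗ₜ CoalgebraStruct.comul (R := ℂ) Q := by
  simp [comulRight]

theorem comulLeft_comul (L : H) : comulLeft H (CoalgebraStruct.comul (R := ℂ) L) =
    comulRight H (CoalgebraStruct.comul (R := ℂ) L) := by
  refine Eq.trans ?_ (Coalgebra.coassoc_apply (R := ℂ) L)
  generalize CoalgebraStruct.comul (R := ℂ) L = X
  induction X with
  | zero => simp
  | add x y hx hy => simp only [map_add, hx, hy]
  | tmul P Q => simp

/-- For `X = P ⊗ Q`, the factor `Q ▷ (L₍₁₎ ▷ g)` equals `(Q L₍₁₎) ▷ g`, so `X` and `δ(L)` multiply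
in the middle leg. As `X` and `δ` are arbitrary, this applies to each pair of coefficients of `F⁻¹`
and `Δ^F`. -/
theorem smashCore_mul'_homTensorHomMap (δ : H →ₗ[ℂ] H ⊗[ℂ] H) (X : H ⊗[ℂ] H) (f g : A) (L M : H) :
    smashCore act (LinearMap.mul' ℂ A ∘ₗ TensorProduct.homTensorHomMap (RingHom.id ℂ) A A A A
        (TensorProduct.map act.toLinearMap act.toLinearMap X)) δ ((f ⊗ₜ L) ⊗ₜ (g ⊗ₜ M)) =
      tripleAct act f g M (leg₁₂ H X * leg₂₃ H (δ L)) := by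
  simp only [smashCore, LinearMap.comp_apply, LinearMap.rTensor_tmul, LinearMap.lTensor_tmul,
    LinearEquiv.coe_coe, TensorProduct.assoc_tmul]
  generalize δ L = Y
  induction Y with
  | zero => simp
  | add x y hx hy =>
    simp only [leg₂₃_apply] at hx hy
    simp only [map_add, TensorProduct.tmul_add, TensorProduct.add_tmul, hx, hy, mul_add,
      leg₂₃_apply]
  | tmul P Q =>
    induction X with
    | zero => simp
    | add x y hx hy =>
      simp only [map_add, LinearMap.comp_add, LinearMap.rTensor_add, LinearMap.add_apply, hx, hy,
        add_mul]
    | tmul R S => simp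

theorem smashCore_mul' (δ : H →ₗ[ℂ] H ⊗[ℂ] H) (f g : A) (L M : H) :
    smashCore act (LinearMap.mul' ℂ A) δ ((f ⊗ₜ L) ⊗ₜ (g ⊗ₜ M)) =
      tripleAct act f g M (leg₂₃ H (δ L)) := by
  have h := smashCore_mul'_homTensorHomMap act δ 1 f g L M
  rw [map_one (leg₁₂ H), one_mul] at h
  rw [← h]
  congr 2
  ext x y
  simp [Algebra.TensorProduct.one_def]

variable {act}

/-- `P` acts on the product `(R ▷ f)(S ▷ g)` through `Δ(P)`, which is how `Δ ⊗ id` enters. -/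
theorem IsModuleAlgebra.tensorAct_tripleAct (hact : IsModuleAlgebra act) (X : H ⊗[ℂ] H)
    (Y : H ⊗[ℂ] (H ⊗[ℂ] H)) (f g : A) (M : H) :
    tensorAct act X (tripleAct act f g M Y) = tripleAct act f g M (comulLeft H X * Y) := by
  induction Y with
  | zero => simp
  | add x y hx hy => simp only [map_add, mul_add, hx, hy]
  | tmul R Z =>
    induction Z with
    | zero => simp
    | add x y hx hy => simp only [map_add, TensorProduct.tmul_add, mul_add, hx, hy]
    | tmul S U =>
      induction X with
      | zero => simp
      | add x y hx hy => simp only [map_add, add_mul, LinearMap.add_apply, hx, hy]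
      | tmul P Q =>
        rw [tripleAct_tmul, tensorAct_tmul, hact.act_mul, comulLeft_tmul]
        generalize CoalgebraStruct.comul (R := ℂ) P = W
        induction W with
        | zero => simp
        | add x y hx hy => simp only [map_add, add_mul, TensorProduct.add_tmul, hx, hy]
        | tmul W₁ W₂ => simp [mul_assoc]

/-- By `Δ(Q L) = Δ(Q) Δ(L)`, the second leg `Q` of `X` splits between `g` and `M`, which is how `id
⊗ Δ` enters. -/
theorem smashCore_tensorAct (X Y : H ⊗[ℂ] H) (f g : A) (L M : H) :
    smashCore act (LinearMap.mul' ℂ A) (CoalgebraStruct.comul (R := ℂ))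
        (tensorAct act X (f ⊗ₜ L) ⊗ₜ tensorAct act Y (g ⊗ₜ M)) =
      tripleAct act f g M
        (comulRight H X * leg₂₃ H (CoalgebraStruct.comul (R := ℂ) L) * leg₂₃ H Y) := by
  induction X with
  | zero => simp
  | add x y hx hy => simp only [map_add, add_mul, LinearMap.add_apply, TensorProduct.add_tmul, hx, hy]
  | tmul P Q =>
    induction Y with
    | zero => simp
    | add x y hx hy =>
      simp only [map_add, mul_add, LinearMap.add_apply, TensorProduct.tmul_add, hx, hy]
    | tmul R S =>
      rw [tensorAct_tmul, tensorAct_tmul, smashCore_mul', Bialgebra.comul_mul, comulRight_tmul]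
      simp only [leg₂₃_apply, Algebra.TensorProduct.tmul_mul_tmul, mul_one]
      generalize CoalgebraStruct.comul (R := ℂ) Q * CoalgebraStruct.comul (R := ℂ) L = W
      induction W with
      | zero => simp
      | add x y hx hy => simp only [map_add, add_mul, TensorProduct.tmul_add, hx, hy]
      | tmul W₁ W₂ => simp [mul_assoc]

/-- Left multiplication by `f ⊗ L` factors into the action of `Δ(L)` followed by multiplication by
`f`. Associativity then only requires each factor to commute with right multiplications, which the
next two lemmas provide. -/
theorem smashCore_eq_rTensor_tensorAct (f : A) (L : H) (b : A ⊗[ℂ] H) :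
    smashCore act (LinearMap.mul' ℂ A) (CoalgebraStruct.comul (R := ℂ)) ((f ⊗ₜ L) ⊗ₜ b) =
      LinearMap.rTensor H (LinearMap.mulLeft ℂ f)
        (tensorAct act (CoalgebraStruct.comul (R := ℂ) L) b) := by
  induction b with
  | zero => simp
  | add x y hx hy => simp only [map_add, TensorProduct.tmul_add, hx, hy]
  | tmul g M =>
    rw [smashCore_mul', leg₂₃_apply]
    generalize CoalgebraStruct.comul (R := ℂ) L = W
    induction W with
    | zero => simp
    | add x y hx hy => simp only [map_add, LinearMap.add_apply, TensorProduct.tmul_add, hx, hy]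
    | tmul W₁ W₂ => simp

theorem smashCore_rTensor_mulLeft (f : A) (a b : A ⊗[ℂ] H) :
    smashCore act (LinearMap.mul' ℂ A) (CoalgebraStruct.comul (R := ℂ))
        (LinearMap.rTensor H (LinearMap.mulLeft ℂ f) a ⊗ₜ b) =
      LinearMap.rTensor H (LinearMap.mulLeft ℂ f)
        (smashCore act (LinearMap.mul' ℂ A) (CoalgebraStruct.comul (R := ℂ)) (a ⊗ₜ b)) := by
  induction a with
  | zero => simp
  | add x y hx hy => simp only [map_add, TensorProduct.add_tmul, hx, hy]
  | tmul g M =>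
    rw [LinearMap.rTensor_tmul, smashCore_eq_rTensor_tensorAct, smashCore_eq_rTensor_tensorAct,
      LinearMap.mulLeft_apply, LinearMap.mulLeft_mul, LinearMap.rTensor_comp,
      LinearMap.comp_apply]

/-- On pure tensors the two sides carry `(Δ ⊗ id)Δ(L)` and `(id ⊗ Δ)Δ(L)`, so this is
coassociativity. -/
theorem IsModuleAlgebra.tensorAct_comul_smashCore (hact : IsModuleAlgebra act) (L : H)
    (b c : A ⊗[ℂ] H) :
    tensorAct act (CoalgebraStruct.comul (R := ℂ) L)
        (smashCore act (LinearMap.mul' ℂ A) (CoalgebraStruct.comul (R := ℂ)) (b ⊗ₜ c)) =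
      smashCore act (LinearMap.mul' ℂ A) (CoalgebraStruct.comul (R := ℂ))
        (tensorAct act (CoalgebraStruct.comul (R := ℂ) L) b ⊗ₜ c) := by
  induction b with
  | zero => simp
  | add x y hx hy => simp only [map_add, TensorProduct.add_tmul, hx, hy]
  | tmul g M =>
    induction c with
    | zero => simp
    | add x y hx hy => simp only [map_add, TensorProduct.tmul_add, hx, hy]
    | tmul k N =>
      have h := smashCore_tensorAct (act := act) (CoalgebraStruct.comul (R := ℂ) L) 1 g k M N
      rw [map_one, map_one, mul_one, Module.End.one_apply] at h
      rw [h, smashCore_mul', hact.tensorAct_tripleAct, comulLeft_comul]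

theorem IsModuleAlgebra.smashCore_assoc (hact : IsModuleAlgebra act) (a b c : A ⊗[ℂ] H) :
    smashCore act (LinearMap.mul' ℂ A) (CoalgebraStruct.comul (R := ℂ))
        (smashCore act (LinearMap.mul' ℂ A) (CoalgebraStruct.comul (R := ℂ)) (a ⊗ₜ b) ⊗ₜ c) =
      smashCore act (LinearMap.mul' ℂ A) (CoalgebraStruct.comul (R := ℂ))
        (a ⊗ₜ smashCore act (LinearMap.mul' ℂ A) (CoalgebraStruct.comul (R := ℂ)) (b ⊗ₜ c)) := by
  induction a with
  | zero => simp
  | add x y hx hy => simp only [map_add, TensorProduct.add_tmul, hx, hy]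
  | tmul f L =>
    rw [smashCore_eq_rTensor_tensorAct, smashCore_eq_rTensor_tensorAct, smashCore_rTensor_mulLeft,
      hact.tensorAct_comul_smashCore]

theorem smashCore_one_tmul (a : A ⊗[ℂ] H) :
    smashCore act (LinearMap.mul' ℂ A) (CoalgebraStruct.comul (R := ℂ)) (1 ⊗ₜ a) = a := by
  rw [Algebra.TensorProduct.one_def, smashCore_eq_rTensor_tensorAct, Bialgebra.comul_one, map_one,
    LinearMap.mulLeft_one, LinearMap.rTensor_id]
  rfl

/-- Stated for general `X` because it serves twice: with `X = Δ(L)` for the right unit law, and with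
`X` a coefficient of `F⁻¹` for `φ(1 ⊗ L) = 1 ⊗ L`. -/
theorem IsModuleAlgebra.tensorAct_one_tmul (hact : IsModuleAlgebra act) (X : H ⊗[ℂ] H) (L : H) :
    tensorAct act X (1 ⊗ₜ L) =
      1 ⊗ₜ (TensorProduct.lid ℂ H
        (LinearMap.rTensor H (CoalgebraStruct.counit (R := ℂ)) X) * L) := by
  induction X with
  | zero => simp
  | add x y hx hy => simp only [map_add, LinearMap.add_apply, add_mul, TensorProduct.tmul_add, hx, hy]
  | tmul P Q => simp [hact.act_one, TensorProduct.smul_tmul]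

theorem IsModuleAlgebra.smashCore_tmul_one (hact : IsModuleAlgebra act) (a : A ⊗[ℂ] H) :
    smashCore act (LinearMap.mul' ℂ A) (CoalgebraStruct.comul (R := ℂ)) (a ⊗ₜ 1) = a := by
  induction a with
  | zero => simp
  | add x y hx hy => simp only [map_add, TensorProduct.add_tmul, hx, hy]
  | tmul f L =>
    rw [Algebra.TensorProduct.one_def, smashCore_eq_rTensor_tensorAct, hact.tensorAct_one_tmul,
      Coalgebra.rTensor_counit_comul]
    simp

/-- The smash product of a module algebra is a unital associative algebra. -/
theorem IsModuleAlgebra.isUnitalAssocAlgebra_smashProduct (hact : IsModuleAlgebra act) :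
    IsUnitalAssocAlgebra (SmashProduct act (HMap.const (LinearMap.mul' ℂ A))
      (HMap.const (CoalgebraStruct.comul (R := ℂ) (A := H)))) := by
  set B := SmashProduct.mulBilin act (HMap.const (LinearMap.mul' ℂ A))
      (HMap.const (CoalgebraStruct.comul (R := ℂ) (A := H)))
  have hC : ∀ x y, B (PowerSeries.C x) (PowerSeries.C y) = _ :=
    SmashProduct.mulBilin_const_C act _ _
  refine SmashProduct.isUnitalAssocAlgebra ?_ ?_ ?_
  · intro a b c
    -- Trilinear extensionality in two stages: `c` is held fixed while `a` and `b` are reduced to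
    -- constants, then `c` is reduced.
    suffices h : ∀ x y : A ⊗[ℂ] H, B (B (PowerSeries.C x) (PowerSeries.C y)) =
        (B (PowerSeries.C x)) ∘ₗ (B (PowerSeries.C y)) by
      have h' : B.compr₂ (B.flip c) = B.compl₂ (B.flip c) :=
        hAdic_bilin_ext fun x y => LinearMap.congr_fun (h x y) c
      exact LinearMap.congr_fun₂ h' a b
    intro x y
    refine hAdic_linearMap_ext fun z => ?_
    rw [LinearMap.comp_apply, hC, hC, hC, hC, hact.smashCore_assoc]
  · intro a
    rw [SmashProduct.one_eq]
    refine LinearMap.congr_fun (f := B (PowerSeries.C 1)) (g := LinearMap.id)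
      (hAdic_linearMap_ext fun x => ?_) a
    rw [hC, smashCore_one_tmul]
    rfl
  · intro a
    rw [SmashProduct.one_eq]
    refine LinearMap.congr_fun (f := B.flip (PowerSeries.C 1)) (g := LinearMap.id)
      (hAdic_linearMap_ext fun x => ?_) a
    rw [LinearMap.flip_apply, hC, hact.smashCore_tmul_one]
    rfl

end ModuleAlgebra

/-! ### The action of the twist and the isomorphism of smash products. -/

section Twist

variable {A H : Type*} [Ring A] [Algebra ℂ A] [Ring H] [Bialgebra ℂ H]
variable (act : H →ₐ[ℂ] Module.End ℂ A)

/-- The `ℂ[[h]]`-linear action of `(H ⊗ H)[[h]]` on `(A ⊗ H)[[h]]`. -/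
def seriesAct (X : (H ⊗[ℂ] H)⟦X⟧) : (A ⊗[ℂ] H)⟦X⟧ →ₗ[ℂ⟦X⟧] (A ⊗[ℂ] H)⟦X⟧ :=
  HMap.toLinear fun k => tensorAct act (PowerSeries.coeff k X)

theorem coeff_seriesAct (X : (H ⊗[ℂ] H)⟦X⟧) (a : (A ⊗[ℂ] H)⟦X⟧) (k : ℕ) :
    PowerSeries.coeff k (seriesAct act X a) =
      ∑ p ∈ Finset.HasAntidiagonal.antidiagonal k,
        tensorAct act (PowerSeries.coeff p.1 X) (PowerSeries.coeff p.2 a) :=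
  HMap.coeff_toLinear _ a k

theorem coeff_seriesAct_C (X : (H ⊗[ℂ] H)⟦X⟧) (x : A ⊗[ℂ] H) (k : ℕ) :
    PowerSeries.coeff k (seriesAct act X (PowerSeries.C x)) =
      tensorAct act (PowerSeries.coeff k X) x :=
  HMap.coeff_toLinear_C _ x k

/-- Multiplicativity in the acting series is what turns `F F⁻¹ = 1 = F⁻¹ F` into mutually inverse
linear maps. -/
theorem seriesAct_mul (X Y : (H ⊗[ℂ] H)⟦X⟧) :
    seriesAct act (X * Y) = seriesAct act X ∘ₗ seriesAct act Y := by
  refine hAdic_linearMap_ext fun x => ?_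
  ext k
  rw [LinearMap.comp_apply, coeff_seriesAct_C, coeff_seriesAct, PowerSeries.coeff_mul, map_sum,
    LinearMap.sum_apply]
  simp only [coeff_seriesAct_C, map_mul, Module.End.mul_apply]

theorem seriesAct_one : seriesAct act (1 : (H ⊗[ℂ] H)⟦X⟧) = LinearMap.id := by
  refine hAdic_linearMap_ext fun x => ?_
  ext k
  rw [coeff_seriesAct_C, PowerSeries.coeff_one, LinearMap.id_apply, PowerSeries.coeff_C]
  split_ifs <;> simp

/-- The coefficientwise extension of `tripleAct` to power series. -/
def seriesTripleAct (f g : A) (M : H) (Z : (H ⊗[ℂ] (H ⊗[ℂ] H))⟦X⟧) : (A ⊗[ℂ] H)⟦X⟧ :=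
  PowerSeries.mk fun k => tripleAct act f g M (PowerSeries.coeff k Z)

variable {act}

theorem IsModuleAlgebra.seriesAct_seriesTripleAct (hact : IsModuleAlgebra act)
    (X : (H ⊗[ℂ] H)⟦X⟧) (Z : (H ⊗[ℂ] (H ⊗[ℂ] H))⟦X⟧) (f g : A) (M : H) :
    seriesAct act X (seriesTripleAct act f g M Z) =
      seriesTripleAct act f g M (PowerSeries.map (comulLeft H).toRingHom X * Z) := by
  ext k
  simp only [coeff_seriesAct, seriesTripleAct, PowerSeries.coeff_mk, PowerSeries.coeff_mul,
    map_sum, hact.tensorAct_tripleAct, PowerSeries.coeff_map, AlgHom.toRingHom_eq_coe,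
    RingHom.coe_coe]

variable (act) in
theorem mulBilin_seriesAct_C (X Y : (H ⊗[ℂ] H)⟦X⟧) (f g : A) (L M : H) :
    SmashProduct.mulBilin act (HMap.const (LinearMap.mul' ℂ A))
        (HMap.const (CoalgebraStruct.comul (R := ℂ) (A := H)))
        (seriesAct act X (PowerSeries.C (f ⊗ₜ L))) (seriesAct act Y (PowerSeries.C (g ⊗ₜ M))) =
      seriesTripleAct act f g M (PowerSeries.map (comulRight H).toRingHom X *
        PowerSeries.map (leg₂₃ H).toRingHom
          (PowerSeries.C (CoalgebraStruct.comul (R := ℂ) L) * Y)) := by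
  have hXL : PowerSeries.map (comulRight H).toRingHom X * PowerSeries.map (leg₂₃ H).toRingHom
          (PowerSeries.C (CoalgebraStruct.comul (R := ℂ) L) * Y) =
      PowerSeries.map (comulRight H).toRingHom X * PowerSeries.C
        (leg₂₃ H (CoalgebraStruct.comul (R := ℂ) L)) * PowerSeries.map (leg₂₃ H).toRingHom Y := by
    rw [map_mul, PowerSeries.map_C, mul_assoc]
    rfl
  ext k
  rw [SmashProduct.coeff_mulBilin_const, hXL, seriesTripleAct, PowerSeries.coeff_mk,
    PowerSeries.coeff_mul, map_sum]
  simp only [coeff_seriesAct_C, smashCore_tensorAct, PowerSeries.coeff_mul_C, PowerSeries.coeff_map,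
    AlgHom.toRingHom_eq_coe, RingHom.coe_coe]

namespace DrinfeldTwist

variable (T : DrinfeldTwist H)

theorem F_mul_inv : (T.F : (H ⊗[ℂ] H)⟦X⟧) * T.inv = 1 := T.F.mul_inv

theorem inv_mul_F : T.inv * (T.F : (H ⊗[ℂ] H)⟦X⟧) = 1 := T.F.inv_mul

theorem coeff_zero_inv : PowerSeries.coeff 0 T.inv = 1 := by
  have h := congrArg (PowerSeries.coeff 0) T.F_mul_inv
  simpa [PowerSeries.coeff_mul, T.coeff_zero] using h

/-- The cocycle condition for the inverse twist,
`(Δ ⊗ id)(F⁻¹) F⁻¹₁₂ = (id ⊗ Δ)(F⁻¹) F⁻¹₂₃`. -/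
theorem cocycle_inv :
    PowerSeries.map (comulLeft H).toRingHom T.inv * PowerSeries.map (leg₁₂ H).toRingHom T.inv =
      PowerSeries.map (comulRight H).toRingHom T.inv *
        PowerSeries.map (leg₂₃ H).toRingHom T.inv := by
  have hmap : ∀ f : H ⊗[ℂ] H →ₐ[ℂ] H ⊗[ℂ] (H ⊗[ℂ] H),
      PowerSeries.map f.toRingHom T.F * PowerSeries.map f.toRingHom T.inv = 1 ∧
      PowerSeries.map f.toRingHom T.inv * PowerSeries.map f.toRingHom T.F = 1 := fun f => by
    rw [← map_mul, ← map_mul, F_mul_inv, inv_mul_F, map_one]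
    exact ⟨rfl, rfl⟩
  have hF : PowerSeries.map (leg₁₂ H).toRingHom T.F * PowerSeries.map (comulLeft H).toRingHom T.F =
      PowerSeries.map (leg₂₃ H).toRingHom T.F *
        PowerSeries.map (comulRight H).toRingHom T.F := by
    refine Eq.trans ?_ T.cocycle
    rw [map_mul]
    congr 1
  -- The left side of the goal is a left inverse of `F₁₂ (Δ ⊗ id)F`. By the cocycle condition this
  -- element is also `F₂₃ (id ⊗ Δ)F`, of which the right side is a right inverse.
  refine left_inv_eq_right_inv (a := PowerSeries.map (leg₁₂ H).toRingHom T.F *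
    PowerSeries.map (comulLeft H).toRingHom T.F) ?_ ?_
  · rw [mul_assoc, ← mul_assoc (PowerSeries.map (leg₁₂ H).toRingHom T.inv), (hmap _).2, one_mul,
      (hmap _).2]
  · rw [hF, mul_assoc, ← mul_assoc (PowerSeries.map (comulRight H).toRingHom T.F.val), (hmap _).1,
      one_mul, (hmap _).1]

variable (act) in
theorem mulBilin_star_comul_C (f g : A) (L M : H) :
    SmashProduct.mulBilin act (T.star act) T.comul (PowerSeries.C (f ⊗ₜ L))
        (PowerSeries.C (g ⊗ₜ M)) =
      seriesTripleAct act f g M (PowerSeries.map (leg₁₂ H).toRingHom T.inv *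
        PowerSeries.map (leg₂₃ H).toRingHom
          ((T.F : (H ⊗[ℂ] H)⟦X⟧) * PowerSeries.C (CoalgebraStruct.comul (R := ℂ) L) * T.inv)) := by
  ext k
  rw [SmashProduct.coeff_mulBilin_C, smashMap, LinearMap.sum_apply, seriesTripleAct,
    PowerSeries.coeff_mk, PowerSeries.coeff_mul, map_sum]
  refine Finset.sum_congr rfl fun p _ => ?_
  rw [star, smashCore_mul'_homTensorHomMap]
  rfl

/-- The linear isomorphism `f ⊗ L ↦ (f̄^α ▷ f) ⊗ f̄_α L`. -/
def untwist (act : H →ₐ[ℂ] Module.End ℂ A) : (A ⊗[ℂ] H)⟦X⟧ ≃ₗ[ℂ⟦X⟧] (A ⊗[ℂ] H)⟦X⟧ :=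
  LinearEquiv.ofLinearMap (seriesAct act T.inv) (seriesAct act T.F)
    (by rw [← seriesAct_mul, inv_mul_F, seriesAct_one])
    (by rw [← seriesAct_mul, F_mul_inv, seriesAct_one])

theorem untwist_apply (a : (A ⊗[ℂ] H)⟦X⟧) : T.untwist act a = seriesAct act T.inv a := rfl

/-- Bilinearity reduces this to constant pure tensors, where both sides are values of
`seriesTripleAct` and it suffices to compare the series inside. -/
theorem untwist_mulBilin (hact : IsModuleAlgebra act) (a b : (A ⊗[ℂ] H)⟦X⟧) :
    T.untwist act (SmashProduct.mulBilin act (T.star act) T.comul a b) =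
      SmashProduct.mulBilin act (HMap.const (LinearMap.mul' ℂ A))
        (HMap.const (CoalgebraStruct.comul (R := ℂ) (A := H)))
        (T.untwist act a) (T.untwist act b) := by
  suffices h : (SmashProduct.mulBilin act (T.star act) T.comul).compr₂ (seriesAct act T.inv) =
      (SmashProduct.mulBilin act (HMap.const (LinearMap.mul' ℂ A))
        (HMap.const (CoalgebraStruct.comul (R := ℂ) (A := H)))).compl₁₂
        (seriesAct act T.inv) (seriesAct act T.inv) from LinearMap.congr_fun₂ h a b
  refine hAdic_bilin_ext fun x y => ?_
  rw [LinearMap.compr₂_apply, LinearMap.compl₁₂_apply]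
  induction x with
  | zero => simp
  | add x x' hx hx' => simp only [map_add, LinearMap.add_apply, hx, hx']
  | tmul f L =>
    induction y with
    | zero => simp
    | add y y' hy hy' => simp only [map_add, hy, hy']
    | tmul g M =>
      -- `cocycle_inv` trades `(Δ ⊗ id)(F⁻¹) F⁻¹₁₂` for `(id ⊗ Δ)(F⁻¹) F⁻¹₂₃`, whose last factor
      -- cancels the `F₂₃` of the twisted coproduct.
      rw [mulBilin_star_comul_C, hact.seriesAct_seriesTripleAct, mulBilin_seriesAct_C,
        ← mul_assoc, cocycle_inv, mul_assoc, ← map_mul, mul_assoc, ← mul_assoc T.inv, inv_mul_F,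
        one_mul]

theorem untwist_hTensor_one (f : A⟦X⟧) :
    T.untwist act (hTensor f 1) = (T.hat act).toLinear f := by
  refine LinearMap.congr_fun (f := seriesAct act T.inv ∘ₗ (hTensorBilin A H).flip 1)
    (g := (T.hat act).toLinear) (hAdic_linearMap_ext fun x => ?_) f
  ext k
  rw [LinearMap.comp_apply, LinearMap.flip_apply, hTensorBilin_apply,
    ← map_one (PowerSeries.C (R := H)), hTensor_C, coeff_seriesAct_C, HMap.coeff_toLinear_C]
  change _ = LinearMap.rTensor H (act.toLinearMap.flip x) (PowerSeries.coeff k T.inv)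
  generalize PowerSeries.coeff k T.inv = Y
  induction Y with
  | zero => simp
  | add y y' hy hy' => simp only [map_add, LinearMap.add_apply, hy, hy']
  | tmul P Q => simp

theorem counit_left_inv :
    PowerSeries.map ((Algebra.TensorProduct.lid ℂ H).toAlgHom.comp
      (Algebra.TensorProduct.map (Bialgebra.counitAlgHom ℂ H) (AlgHom.id ℂ H))).toRingHom T.inv
      = 1 := by
  have h := congrArg (PowerSeries.map ((Algebra.TensorProduct.lid ℂ H).toAlgHom.comp
      (Algebra.TensorProduct.map (Bialgebra.counitAlgHom ℂ H) (AlgHom.id ℂ H))).toRingHom)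
      T.F_mul_inv
  rwa [map_mul, T.counit_left, one_mul, map_one] at h

/-- Since `f̄^α ▷ 1 = ε(f̄^α) 1`, the image is `1 ⊗ ε(f̄^α) f̄_α L`, and `(ε ⊗ id)F⁻¹ = 1`. -/
theorem untwist_one_hTensor (hact : IsModuleAlgebra act) (L : H⟦X⟧) :
    T.untwist act (hTensor 1 L) = hTensor 1 L := by
  refine LinearMap.congr_fun (f := seriesAct act T.inv ∘ₗ hTensorBilin A H 1)
    (g := hTensorBilin A H 1) (hAdic_linearMap_ext fun x => ?_) L
  ext k
  rw [LinearMap.comp_apply, hTensorBilin_apply,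
    ← map_one (PowerSeries.C (R := A)), hTensor_C, coeff_seriesAct_C, hact.tensorAct_one_tmul]
  have h := congrArg (PowerSeries.coeff k) T.counit_left_inv
  rw [PowerSeries.coeff_map] at h
  change TensorProduct.lid ℂ H (LinearMap.rTensor H (CoalgebraStruct.counit (R := ℂ))
    (PowerSeries.coeff k T.inv)) = _ at h
  rw [h, PowerSeries.coeff_one, PowerSeries.coeff_C]
  split_ifs <;> simp

theorem exists_untwist_eq_add_X_smul (a : (A ⊗[ℂ] H)⟦X⟧) :
    ∃ c : (A ⊗[ℂ] H)⟦X⟧, T.untwist act a = a + (PowerSeries.X : ℂ⟦X⟧) • c := by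
  have h : PowerSeries.X ∣ T.untwist act a - a := by
    rw [PowerSeries.X_dvd_iff, ← PowerSeries.coeff_zero_eq_constantCoeff_apply, map_sub,
      untwist_apply, coeff_seriesAct]
    simp [coeff_zero_inv]
  obtain ⟨c, hc⟩ := h
  exact ⟨c, by rw [hAdic_X_smul, ← hc, add_sub_cancel]⟩

/-- `untwist` as a map of smash products. -/
def smashEquiv (act : H →ₐ[ℂ] Module.End ℂ A) :
    SmashProduct act (T.star act) T.comul ≃ₗ[ℂ⟦X⟧]
      SmashProduct act (HMap.const (LinearMap.mul' ℂ A))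
        (HMap.const (CoalgebraStruct.comul (R := ℂ) (A := H))) :=
  (SmashProduct.ofSeries _ _ _).symm.trans ((T.untwist act).trans (SmashProduct.ofSeries _ _ _))

theorem smashEquiv_mul (hact : IsModuleAlgebra act)
    (a b : SmashProduct act (T.star act) T.comul) :
    T.smashEquiv act (a * b) = T.smashEquiv act a * T.smashEquiv act b :=
  T.untwist_mulBilin hact a b

theorem smashEquiv_one (hact : IsModuleAlgebra act) : T.smashEquiv act 1 = 1 :=
  T.untwist_one_hTensor hact 1

/-- The twisted smash product is a unital associative algebra. -/
theorem isUnitalAssocAlgebra_smashProduct (hact : IsModuleAlgebra act) :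
    IsUnitalAssocAlgebra (SmashProduct act (T.star act) T.comul) := by
  have h := hact.isUnitalAssocAlgebra_smashProduct
  -- Each law holds after applying the injective multiplicative map `smashEquiv`, hence before.
  refine SmashProduct.isUnitalAssocAlgebra (fun a b c => ?_) (fun a => ?_) (fun a => ?_) <;>
    apply (T.smashEquiv act).injective
  · simp only [T.smashEquiv_mul hact, h.mul_assoc]
  · rw [T.smashEquiv_mul hact, T.smashEquiv_one hact, h.one_mul]
  · rw [T.smashEquiv_mul hact, T.smashEquiv_one hact, h.mul_one]

end DrinfeldTwist

end Twist

/-! ### Polynomials as a module algebra over `U(𝔦𝔤𝔩(n))`. -/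

section Igl

attribute [local instance 100] LieRing.ofAssociativeRing

/-- A linear map between two `U(𝔤)`-modules that commutes with `𝔤` commutes with `U(𝔤)`. -/
theorem envelopingAlgebra_intertwine {𝔤 : Type} [LieRing 𝔤] [LieAlgebra ℂ 𝔤] {V W : Type*}
    [AddCommGroup V] [Module ℂ V] [AddCommGroup W] [Module ℂ W]
    (ρ : UniversalEnvelopingAlgebra ℂ 𝔤 →ₐ[ℂ] Module.End ℂ V)
    (σ : UniversalEnvelopingAlgebra ℂ 𝔤 →ₐ[ℂ] Module.End ℂ W) (t : V →ₗ[ℂ] W)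
    (h : ∀ (u : 𝔤) (v : V), t (ρ (UniversalEnvelopingAlgebra.ι ℂ u) v) =
      σ (UniversalEnvelopingAlgebra.ι ℂ u) (t v))
    (L : UniversalEnvelopingAlgebra ℂ 𝔤) (v : V) : t (ρ L v) = σ L (t v) := by
  -- The elements that commute with `t` form a subalgebra containing `𝔤`. It is everything: the lift
  -- of `𝔤 → S` to the enveloping algebra, followed by the inclusion, fixes `𝔤` and so is the
  -- identity.
  let S : Subalgebra ℂ (UniversalEnvelopingAlgebra ℂ 𝔤) :=
    { carrier := {L | ∀ v, t (ρ L v) = σ L (t v)}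
      mul_mem' := fun {a b} ha hb v => by
        simp only [map_mul, Module.End.mul_apply, ha _, hb _]
      add_mem' := fun {a b} ha hb v => by
        simp only [map_add, LinearMap.add_apply, ha _, hb _]
      algebraMap_mem' := fun c v => by
        simp only [AlgHom.commutes, Module.algebraMap_end_apply, map_smul] }
  let j : 𝔤 →ₗ⁅ℂ⁆ S :=
    { toFun := fun u => ⟨UniversalEnvelopingAlgebra.ι ℂ u, h u⟩
      map_add' := fun x y => Subtype.ext (map_add _ x y)
      map_smul' := fun c x => Subtype.ext (map_smul _ c x)
      map_lie' := fun {x y} => Subtype.ext (LieHom.map_lie _ x y) }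
  have hj : S.val.comp (UniversalEnvelopingAlgebra.lift ℂ j) = AlgHom.id ℂ _ := by
    apply UniversalEnvelopingAlgebra.hom_ext
    apply LieHom.ext
    intro u
    change (UniversalEnvelopingAlgebra.lift ℂ j (UniversalEnvelopingAlgebra.ι ℂ u) :
      UniversalEnvelopingAlgebra ℂ 𝔤) = UniversalEnvelopingAlgebra.ι ℂ u
    rw [UniversalEnvelopingAlgebra.lift_ι_apply]
    rfl
  have hL : (UniversalEnvelopingAlgebra.lift ℂ j L : UniversalEnvelopingAlgebra ℂ 𝔤) = L :=
    DFunLike.congr_fun hj L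
  rw [← hL]
  exact (UniversalEnvelopingAlgebra.lift ℂ j L).2 v

/-- The two axioms say that the multiplication `A ⊗ A → A` and the unit `ℂ → A` commute with the
action of `U`. It is enough to test this on the Lie algebra, which acts by derivations: there the
claims are the Leibniz rule and the vanishing of derivations on constants. -/
theorem iglAction_isModuleAlgebra (n : ℕ) : IsModuleAlgebra (iglAction n) where
  act_mul L f g := by
    have h := envelopingAlgebra_intertwine
      (((Module.endTensorEndAlgHom (R := ℂ) (S := ℂ) (A := ℂ) (M := Coord n) (N := Coord n)).comp
        (Algebra.TensorProduct.map (iglAction n) (iglAction n))).comp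
          (Bialgebra.comulAlgHom ℂ (UIGL n)))
      (iglAction n) (LinearMap.mul' ℂ (Coord n)) (fun u v => ?_) L (f ⊗ₜ g)
    · rw [LinearMap.mul'_apply] at h
      rw [← h, AlgHom.comp_apply, AlgHom.comp_apply, Bialgebra.comulAlgHom_apply]
      generalize CoalgebraStruct.comul (R := ℂ) L = X
      congr 1
      induction X with
      | zero => simp
      | add x y hx hy => simp only [map_add, LinearMap.add_apply, hx, hy]
      | tmul P Q =>
        rw [Algebra.TensorProduct.map_tmul, Module.endTensorEndAlgHom_apply]
        rfl
    · have hΔ : Bialgebra.comulAlgHom ℂ (UIGL n) (UniversalEnvelopingAlgebra.ι ℂ u) =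
          UniversalEnvelopingAlgebra.ι ℂ u ⊗ₜ 1 + 1 ⊗ₜ UniversalEnvelopingAlgebra.ι ℂ u :=
        envComul_ι (IGL n) u
      rw [AlgHom.comp_apply, hΔ, AlgHom.comp_apply, map_add, map_add, Algebra.TensorProduct.map_tmul,
        Algebra.TensorProduct.map_tmul, Module.endTensorEndAlgHom_apply,
        Module.endTensorEndAlgHom_apply, map_one]
      induction v with
      | zero => simp
      | add x y hx hy => simp only [map_add, hx, hy]
      | tmul f g =>
        rw [LinearMap.add_apply, TensorProduct.AlgebraTensorModule.map_tmul,
          TensorProduct.AlgebraTensorModule.map_tmul, map_add, LinearMap.mul'_apply,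
          LinearMap.mul'_apply, LinearMap.mul'_apply, iglAction_ι, iglAction_ι, iglAction_ι,
          Derivation.leibniz, Module.End.one_apply, Module.End.one_apply, smul_eq_mul, smul_eq_mul]
        ring
  act_one L := by
    have h := envelopingAlgebra_intertwine
      ((Algebra.lmul ℂ ℂ).comp (Bialgebra.counitAlgHom ℂ (UIGL n)))
      (iglAction n) (Algebra.linearMap ℂ (Coord n)) (fun u v => ?_) L 1
    · rw [Algebra.linearMap_apply, Algebra.linearMap_apply, map_one (algebraMap ℂ _)] at h
      rw [← h, ← Algebra.algebraMap_eq_smul_one]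
      congr 1
      exact mul_one _
    · have hε : Bialgebra.counitAlgHom ℂ (UIGL n) (UniversalEnvelopingAlgebra.ι ℂ u) = 0 :=
        envCounit_ι (IGL n) u
      rw [AlgHom.comp_apply, hε, map_zero, LinearMap.zero_apply, map_zero, iglAction_ι,
        Algebra.linearMap_apply, Derivation.map_algebraMap]

end Igl

end TwistSmash

end

theorem proposition2 (n : ℕ) (T : DrinfeldTwist (UIGL n)) :
    IsUnitalAssocAlgebra (IGLSmash n) ∧
    IsUnitalAssocAlgebra (TwistedIGLSmash T) ∧
    ∃ φ : TwistedIGLSmash T ≃ₗ[ℂ⟦X⟧] IGLSmash n,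
      φ 1 = 1 ∧
      (∀ a b : TwistedIGLSmash T, φ (a * b) = φ a * φ b) ∧
      (∀ f : (Coord n)⟦X⟧, (φ (SmashProduct.inl f)).series =
        (T.hat (iglAction n)).toLinear f) ∧
      (∀ L : (UIGL n)⟦X⟧, φ (SmashProduct.inr L) = SmashProduct.inr L) ∧
      (∀ a : TwistedIGLSmash T, ∃ c : (Coord n ⊗[ℂ] UIGL n)⟦X⟧,
        (φ a).series = a.series + (PowerSeries.X : ℂ⟦X⟧) • c) :=
  have hact := iglAction_isModuleAlgebra n
  ⟨hact.isUnitalAssocAlgebra_smashProduct, T.isUnitalAssocAlgebra_smashProduct hact,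
    T.smashEquiv (iglAction n), T.smashEquiv_one hact, T.smashEquiv_mul hact,
    T.untwist_hTensor_one, T.untwist_one_hTensor hact, T.exists_untwist_eq_add_X_smul⟩
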